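/- For a group $G$ let $M(G)=H_2(G,\mathbb{Z})$ denote its Schur multiplier, and let \[ B_0(G)=\operatorname{Ker}\Big(H^2(G,\mathbb{Q}/\mathbb{Z})\to\prod_{A}H^2(A,\mathbb{Q}/\mathbb{Z})\Big) \] denote its Bogomolov multiplier, where $\mathbb{Z}$ and $\mathbb{Q}/\mathbb{Z}$ carry the trivial action, $A$ runs over all abelian subgroups of $G$, and the maps are the restriction maps. A group is called metacyclic if it has a cyclic normal subgroup with cyclic quotient. Let $G$ be a group (finite or infinite) that satisfies one of the following conditions: (i) $G$ is metacyclic; (ii) $M(G)=0$, or $M(G)\cong\mathbb{Z}/2\mathbb{Z}$ and $B_0(G)=0$. Then for every central extension $1\to C\to X\to G\to 1$ (that is, every short exact sequence of groups in which the image of $C$ lies in the centre of $X$) we have $B_0(X)=0$. -/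

import Mathlib

universe u v w

/-- A group is metacyclic if it has a cyclic normal subgroup with cyclic quotient. -/
def IsMetacyclic (G : Type u) [Group G] : Prop :=
  ∃ (N : Subgroup G) (_ : N.Normal), IsCyclic N ∧ IsCyclic (G ⧸ N)

/-- The trivial `G`-module `ℤ`. The coefficient ring `ℤ` is lifted to the universe of `G`,
because group (co)homology takes the ring and the group in the same universe. -/
noncomputable abbrev trivialZ (G : Type u) [Group G] : Rep.{u} (ULift.{u} ℤ) G :=
  Rep.trivial (ULift.{u} ℤ) G (ULift.{u} ℤ)

/-- The trivial `G`-module `ℚ/ℤ`. -/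
noncomputable abbrev trivialQZ (G : Type u) [Group G] : Rep.{u} (ULift.{u} ℤ) G :=
  Rep.trivial (ULift.{u} ℤ) G (ULift.{u} (AddCircle (1 : ℚ)))

/-- The Schur multiplier `M(G) = H₂(G, ℤ)`. -/
noncomputable abbrev SchurMultiplier (G : Type u) [Group G] : Type u :=
  groupHomology (trivialZ G) 2

/-- The restriction map `H²(G, ℚ/ℤ) → H²(A, ℚ/ℤ)` for a subgroup `A` of `G`. -/
noncomputable def restrictionH2 {G : Type u} [Group G] (A : Subgroup G) :
    groupCohomology (trivialQZ G) 2 →ₗ[ULift.{u} ℤ] groupCohomology (trivialQZ A) 2 :=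
  (groupCohomology.map (A := trivialQZ G) (B := trivialQZ A) A.subtype
    (Rep.ofHom ⟨LinearMap.id, fun _ => rfl⟩) 2).hom

/-- The Bogomolov multiplier `B₀(G)`: the classes in `H²(G, ℚ/ℤ)` whose restriction to every
abelian subgroup of `G` is zero. -/
noncomputable def bogomolovMultiplier (G : Type u) [Group G] :
    Submodule (ULift.{u} ℤ) (groupCohomology (trivialQZ G) 2) :=
  ⨅ (A : Subgroup G) (_ : IsMulCommutative A), LinearMap.ker (restrictionH2 A)

/-! A class lies in `B₀(X)` exactly when its cocycles `f` are symmetric on commuting pairs. Let `Y`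
be the central extension of `X` by `ℚ/ℤ` given by such an `f`. Elements of `Y` with commuting images
in `X` commute, so `Y → G` is again a central extension. The class of `f` is trivial as soon as
`ℚ/ℤ` is a retract of `Y`.

If `G` is metacyclic, `Y` is abelian-by-cyclic, so every element of `[Y, Y]` is a commutator. A
commutator lying in `ℚ/ℤ` has entries commuting in `X`, hence in `Y`, so it is trivial. Thus `ℚ/ℤ`
meets `[Y, Y]` trivially, and injectivity of `ℚ/ℤ` gives a retraction.

In case (ii), extend the identity of `ℚ/ℤ` to a character `χ` of `Z(Y)`. A retraction exists once
the pushout cocycle of `χ` on `G` is a coboundary. If every character killing `ℚ/ℤ` has trivial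
pushout, commuting pairs of `G` lift to commuting pairs of `Y`, and `B₀(G) = 0` applies to `χ`.
Otherwise some such `ψ` has nontrivial pushout; since `H²(G, ℚ/ℤ)` has at most two elements, `χ` or
`ψχ` has trivial pushout. -/

/-- `ℚ/ℤ`, written additively. -/
abbrev QmodZ : Type := AddCircle (1 : ℚ)

/-! ### Characters with values in `ℚ/ℤ` -/

section Extension

/-- Injectivity of `ℚ/ℤ`: a character that is trivial on the kernel of `p` factors through `p`. -/
theorem exists_addMonoidHom_comp_eq {K B : Type*} [AddCommGroup K] [AddCommGroup B]
    (p : K →+ B) (χ : K →+ QmodZ) (h : p.ker ≤ χ.ker) : ∃ ψ : B →+ QmodZ, ∀ k, ψ (p k) = χ k := by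
  let χ' : p.range →+ QmodZ :=
    p.rangeRestrict.liftOfSurjective p.rangeRestrict_surjective
      ⟨χ, fun k hk => h (by simpa using hk)⟩
  obtain ⟨ψ, hψ⟩ := CharacterModule.dual_surjective_of_injective
    (p.range.subtype.toIntLinearMap) p.range.subtype_injective χ'
  refine ⟨ψ, fun k => ?_⟩
  have h1 : ψ (p k) = χ' (p.rangeRestrict k) := by rw [← hψ]; rfl
  refine h1.trans ?_
  exact AddMonoidHom.liftOfRightInverse_comp_apply _ _ _ ⟨χ, _⟩ k

theorem exists_monoidHom_comp_eq {K B : Type*} [CommGroup K] [CommGroup B]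
    (p : K →* B) (χ : K →* Multiplicative QmodZ) (h : ∀ k, p k = 1 → χ k = 1) :
    ∃ ψ : B →* Multiplicative QmodZ, ∀ k, ψ (p k) = χ k := by
  obtain ⟨ψ, hψ⟩ := exists_addMonoidHom_comp_eq (MonoidHom.toAdditive p)
    (MonoidHom.toAdditiveLeft χ) (fun k hk => h k.toMul hk)
  exact ⟨AddMonoidHom.toMultiplicativeRight ψ, fun k => hψ (Additive.ofMul k)⟩

theorem exists_monoidHom_ne_one {B : Type*} [CommGroup B] (S : Subgroup B) {b : B} (hb : b ∉ S) :
    ∃ ψ : B →* Multiplicative QmodZ, (∀ s ∈ S, ψ s = 1) ∧ ψ b ≠ 1 := by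
  have hb' : Additive.ofMul (QuotientGroup.mk' S b) ≠ 0 := fun h =>
    hb ((QuotientGroup.eq_one_iff b).1 h)
  obtain ⟨c, hc⟩ := CharacterModule.exists_character_apply_ne_zero_of_ne_zero hb'
  let c' : Additive (B ⧸ S) →+ QmodZ := c
  refine ⟨(AddMonoidHom.toMultiplicativeRight c').comp (QuotientGroup.mk' S), fun s hs => ?_, hc⟩
  have : QuotientGroup.mk' S s = 1 := (QuotientGroup.eq_one_iff s).2 hs
  rw [MonoidHom.comp_apply, this, map_one]

end Extension

/-! ### Cocycles and the extensions they define -/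

section Cocycles

variable {X : Type*} [Group X]

/-- Inhomogeneous 2-cocycles with values in the trivial module `ℚ/ℤ`. -/
def IsQZCocycle (f : X → X → QmodZ) : Prop :=
  ∀ x y z, f (x * y) z + f x y = f y z + f x (y * z)

/-- Inhomogeneous 2-coboundaries with values in the trivial module `ℚ/ℤ`. -/
def IsQZCoboundary (f : X → X → QmodZ) : Prop :=
  ∃ φ : X → QmodZ, ∀ x y, φ y - φ (x * y) + φ x = f x y

variable (X) in
/-- Every cocycle that is symmetric on commuting pairs is a coboundary. -/
def CommSymmCocyclesTrivial : Prop :=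
  ∀ f : X → X → QmodZ, IsQZCocycle f → (∀ x y, Commute x y → f x y = f y x) → IsQZCoboundary f

theorem IsQZCocycle.one_left {f : X → X → QmodZ} (hf : IsQZCocycle f) (y : X) :
    f 1 y = f 1 1 := by
  simpa [eq_comm] using hf 1 1 y

/-- The underlying type of the central extension of `X` by `ℚ/ℤ` defined by the cocycle `f`. -/
@[ext]
structure CocycleExt {f : X → X → QmodZ} (hf : IsQZCocycle f) where
  /-- The component in `ℚ/ℤ`. -/
  fst : QmodZ
  /-- The component in `X`. -/
  snd : X

namespace CocycleExt

variable {f : X → X → QmodZ} {hf : IsQZCocycle f}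

instance : Mul (CocycleExt hf) := ⟨fun a b => ⟨a.fst + b.fst + f a.snd b.snd, a.snd * b.snd⟩⟩
-- Cocycles are not assumed normalised, hence the corrections by `f 1 1` here, in the inverse and in
-- `incl`.
instance : One (CocycleExt hf) := ⟨⟨-f 1 1, 1⟩⟩
instance : Inv (CocycleExt hf) := ⟨fun a => ⟨-a.fst - f a.snd⁻¹ a.snd - f 1 1, a.snd⁻¹⟩⟩

@[simp] theorem mul_fst (a b : CocycleExt hf) : (a * b).fst = a.fst + b.fst + f a.snd b.snd := rfl
@[simp] theorem mul_snd (a b : CocycleExt hf) : (a * b).snd = a.snd * b.snd := rfl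
@[simp] theorem one_fst : (1 : CocycleExt hf).fst = -f 1 1 := rfl
@[simp] theorem one_snd : (1 : CocycleExt hf).snd = 1 := rfl
@[simp] theorem inv_fst (a : CocycleExt hf) :
    a⁻¹.fst = -a.fst - f a.snd⁻¹ a.snd - f 1 1 := rfl
@[simp] theorem inv_snd (a : CocycleExt hf) : a⁻¹.snd = a.snd⁻¹ := rfl

instance : Group (CocycleExt hf) :=
  Group.ofLeftAxioms
    (fun a b c => by
      ext
      · simp only [mul_fst, mul_snd]
        rw [show a.fst + b.fst + f a.snd b.snd + c.fst + f (a.snd * b.snd) c.snd =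
          a.fst + b.fst + c.fst + (f (a.snd * b.snd) c.snd + f a.snd b.snd) by abel, hf]
        abel
      · simp [mul_assoc])
    (fun a => by ext <;> simp [hf.one_left])
    (fun a => by
      ext
      · simp only [mul_fst, inv_fst, inv_snd, one_fst]; abel
      · simp)

/-- The projection onto `X`. -/
def proj (hf : IsQZCocycle f) : CocycleExt hf →* X where
  toFun := snd
  map_one' := rfl
  map_mul' _ _ := rfl

theorem proj_surjective (hf : IsQZCocycle f) : Function.Surjective (proj hf) :=
  fun x => ⟨⟨0, x⟩, rfl⟩

/-- The inclusion of `ℚ/ℤ`. -/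
def incl (hf : IsQZCocycle f) : Multiplicative QmodZ →* CocycleExt hf where
  toFun a := ⟨a.toAdd - f 1 1, 1⟩
  map_one' := by ext <;> simp
  map_mul' a b := by
    ext
    · simp only [toAdd_mul, mul_fst]; abel
    · simp

theorem incl_injective (hf : IsQZCocycle f) : Function.Injective (incl hf) := by
  intro a b h
  have := congrArg fst h
  simpa [incl] using this

theorem proj_incl (hf : IsQZCocycle f) (a : Multiplicative QmodZ) : proj hf (incl hf a) = 1 := rfl

/-- Applying the retraction to the section `x ↦ (0, x)`, whose factor set is `f`, gives the bounding
cochain. -/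
theorem isQZCoboundary_of_retraction (r : CocycleExt hf →* Multiplicative QmodZ)
    (hr : ∀ a, r (incl hf a) = a) : IsQZCoboundary f := by
  refine ⟨fun x => (r ⟨0, x⟩).toAdd, fun x y => ?_⟩
  have h1 : (⟨0, x⟩ : CocycleExt hf) * ⟨0, y⟩ =
      incl hf (Multiplicative.ofAdd (f x y)) * ⟨0, x * y⟩ := by
    ext
    · simp [incl, hf.one_left]
    · simp [incl]
  have h2 := congrArg (fun z => (r z).toAdd) h1
  simp only [map_mul, hr, toAdd_mul, toAdd_ofAdd] at h2
  rw [sub_add_eq_add_sub, add_comm (r _).toAdd, h2, add_sub_cancel_right]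

/-- Under this hypothesis `ℚ/ℤ` embeds in the abelianization, where its identity character extends.
-/
theorem isQZCoboundary_of_commutator
    (h : ∀ a, incl hf a ∈ commutator (CocycleExt hf) → a = 1) : IsQZCoboundary f := by
  obtain ⟨ψ, hψ⟩ := exists_monoidHom_comp_eq (Abelianization.of.comp (incl hf))
    (MonoidHom.id _) (fun a ha => h a ((QuotientGroup.eq_one_iff _).1 ha))
  exact isQZCoboundary_of_retraction (ψ.comp Abelianization.of) hψ

/-- This is how the symmetry of `f` enters every later argument. -/
theorem commute_of_commute_proj (hs : ∀ x y, Commute x y → f x y = f y x) {a b : CocycleExt hf}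
    (h : Commute (proj hf a) (proj hf b)) : Commute a b := by
  refine CocycleExt.ext ?_ h
  have := hs _ _ h
  simp only [mul_fst]
  change _ + f (proj hf a) (proj hf b) = _ + f (proj hf b) (proj hf a)
  rw [this, add_comm a.fst]

end CocycleExt

theorem IsQZCocycle.isQZCoboundary_of_symm {f : X → X → QmodZ} (hf : IsQZCocycle f)
    (hX : ∀ x y : X, Commute x y) (hs : ∀ x y, f x y = f y x) : IsQZCoboundary f := by
  refine CocycleExt.isQZCoboundary_of_commutator (hf := hf) fun a ha => ?_
  have hc : commutator (CocycleExt hf) = ⊥ := by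
    rw [commutator_def, Subgroup.commutator_eq_bot_iff_le_centralizer]
    intro a _ b _
    exact CocycleExt.commute_of_commute_proj (fun x y _ => hs x y) (hX _ _)
  rw [hc, Subgroup.mem_bot] at ha
  exact CocycleExt.incl_injective hf (ha.trans (map_one _).symm)

end Cocycles

/-! ### Abelian-by-cyclic groups and the metacyclic case -/

section AbelianByCyclic

open scoped commutatorElement

/-- In an abelian-by-cyclic group every element of the commutator subgroup is a commutator. -/
theorem exists_commutatorElement_of_mem_commutator {Y Q : Type*} [Group Y] [Group Q] [IsCyclic Q]
    (q : Y →* Q) (hq : Function.Surjective q) (hA : ∀ x ∈ q.ker, ∀ y ∈ q.ker, Commute x y)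
    {c : Y} (hc : c ∈ commutator Y) : ∃ x y : Y, ⁅x, y⁆ = c := by
  obtain ⟨t, ht⟩ := IsCyclic.exists_generator (α := Q)
  obtain ⟨b, rfl⟩ := hq t
  have hdec : ∀ y, ∃ x ∈ q.ker, ∃ n : ℤ, y = x * b ^ n := fun y => by
    obtain ⟨n, hn⟩ := ht (q y)
    refine ⟨y * (b ^ n)⁻¹, ?_, n, by group⟩
    simp only at hn
    rw [MonoidHom.mem_ker, map_mul, map_inv, map_zpow, hn, mul_inv_cancel]
  have hker : ∀ x ∈ q.ker, ⁅x, b⁆ ∈ q.ker := fun x hx => by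
    rw [MonoidHom.mem_ker, map_commutatorElement, MonoidHom.mem_ker.1 hx, commutatorElement_one_left]
  have hconj : ∀ x ∈ q.ker, ∀ g, g * x * g⁻¹ ∈ q.ker := fun x hx g => q.normal_ker.conj_mem x hx g
  -- On the abelian normal subgroup `q.ker` the map `x ↦ ⁅x, b⁆` is a homomorphism, so its image is
  -- a subgroup.
  have hmul : ∀ x ∈ q.ker, ∀ y ∈ q.ker, ⁅x, b⁆ * ⁅y, b⁆ = ⁅x * y, b⁆ := fun x hx y hy => by
    have h1 : Commute y ((b * x⁻¹ * b⁻¹)) := hA _ hy _ (hconj _ (inv_mem hx) _)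
    have h2 : Commute (x * (b * x⁻¹ * b⁻¹)) y := (hA _ hx _ hy).mul_left h1.symm
    calc ⁅x, b⁆ * ⁅y, b⁆ = (x * (b * x⁻¹ * b⁻¹)) * y * (b * y⁻¹ * b⁻¹) := by
          simp only [commutatorElement_def]; group
      _ = x * y * ((b * x⁻¹ * b⁻¹) * (b * y⁻¹ * b⁻¹)) := by
          rw [mul_assoc x, ← h1.eq]; group
      _ = x * y * ((b * y⁻¹ * b⁻¹) * (b * x⁻¹ * b⁻¹)) := by
          rw [(hA _ (hconj _ (inv_mem hx) b) _ (hconj _ (inv_mem hy) b)).eq]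
      _ = ⁅x * y, b⁆ := by simp only [commutatorElement_def]; group
  let S : Subgroup Y :=
    { carrier := {c | ∃ x ∈ q.ker, ⁅x, b⁆ = c}
      mul_mem' := by
        rintro _ _ ⟨x, hx, rfl⟩ ⟨y, hy, rfl⟩
        exact ⟨x * y, mul_mem hx hy, (hmul x hx y hy).symm⟩
      one_mem' := ⟨1, one_mem _, commutatorElement_one_left b⟩
      inv_mem' := by
        rintro _ ⟨x, hx, rfl⟩
        refine ⟨x⁻¹, inv_mem hx, eq_inv_of_mul_eq_one_left ?_⟩
        rw [hmul _ (inv_mem hx) _ hx, inv_mul_cancel, commutatorElement_one_left] }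
  have hS : S.Normal := ⟨by
    rintro _ ⟨x, hx, rfl⟩ g
    obtain ⟨a, ha, n, rfl⟩ := hdec g
    refine ⟨b ^ n * x * (b ^ n)⁻¹, hconj x hx _, ?_⟩
    have h1 := (hA _ ha _ (hker _ (hconj x hx (b ^ n)))).eq
    have h2 : b ^ n * ⁅x, b⁆ * (b ^ n)⁻¹ = ⁅b ^ n * x * (b ^ n)⁻¹, b⁆ := by
      simp only [commutatorElement_def]; group
    calc _ = a * ⁅b ^ n * x * (b ^ n)⁻¹, b⁆ * a⁻¹ := by rw [h1]; group
      _ = _ := by rw [← h2]; group⟩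
  -- Modulo `S` the lift `b` of a generator centralises the abelian group `q.ker`; together they
  -- generate `Y`, so `Y ⧸ S` is abelian.
  have hle : commutator Y ≤ S := by
    rw [commutator_def, Subgroup.commutator_le]
    intro y _ z _
    obtain ⟨x, hx, m, rfl⟩ := hdec y
    obtain ⟨x', hx', n, rfl⟩ := hdec z
    rw [← QuotientGroup.eq_one_iff (N := S), ← QuotientGroup.mk'_apply, map_commutatorElement,
      commutatorElement_eq_one_iff_commute]
    have hb : ∀ x ∈ q.ker, Commute (QuotientGroup.mk' S x) (QuotientGroup.mk' S b) :=
      fun x hx => by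
        rw [← commutatorElement_eq_one_iff_commute, ← map_commutatorElement]
        exact (QuotientGroup.eq_one_iff _).2 ⟨x, hx, rfl⟩
    simp only [map_mul, map_zpow]
    have hxx := (hA x hx x' hx').map (QuotientGroup.mk' S)
    exact (hxx.mul_right ((hb x hx).zpow_right n)).mul_left
      (((hb x' hx').symm.zpow_left m).mul_right ((Commute.refl _).zpow_zpow m n))
  obtain ⟨x, -, h⟩ := hle hc
  exact ⟨x, b, h⟩

theorem CommSymmCocyclesTrivial.of_abelian_by_cyclic {X Q : Type*} [Group X] [Group Q] [IsCyclic Q]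
    (q : X →* Q) (hq : Function.Surjective q) (hA : ∀ x ∈ q.ker, ∀ y ∈ q.ker, Commute x y) :
    CommSymmCocyclesTrivial X := by
  intro f hf hs
  refine CocycleExt.isQZCoboundary_of_commutator (hf := hf) fun a ha => ?_
  obtain ⟨x, y, hxy⟩ := exists_commutatorElement_of_mem_commutator
    (q.comp (CocycleExt.proj hf)) (hq.comp (CocycleExt.proj_surjective hf))
    (fun x hx y hy => CocycleExt.commute_of_commute_proj hs (hA _ hx _ hy)) ha
  have h1 : Commute (CocycleExt.proj hf x) (CocycleExt.proj hf y) := by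
    rw [← commutatorElement_eq_one_iff_commute, ← map_commutatorElement, hxy,
      CocycleExt.proj_incl]
  have h2 := CocycleExt.commute_of_commute_proj hs h1
  rw [← commutatorElement_eq_one_iff_commute, hxy] at h2
  exact CocycleExt.incl_injective hf (h2.trans (map_one _).symm)

/-- The preimage of the cyclic normal subgroup is central-by-cyclic, hence abelian, and its quotient
is cyclic. -/
theorem CommSymmCocyclesTrivial.of_central_extension_isMetacyclic {X : Type*} {G : Type u}
    [Group X] [Group G] (π : X →* G) (hπ : Function.Surjective π)
    (hc : π.ker ≤ Subgroup.center X) (hG : IsMetacyclic G) : CommSymmCocyclesTrivial X := by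
  obtain ⟨N, hN, hN1, hN2⟩ := hG
  refine of_abelian_by_cyclic ((QuotientGroup.mk' N).comp π)
    ((QuotientGroup.mk'_surjective N).comp hπ) fun x hx y hy => ?_
  have hx' : x ∈ N.comap π := (QuotientGroup.eq_one_iff (π x)).1 hx
  have hy' : y ∈ N.comap π := (QuotientGroup.eq_one_iff (π y)).1 hy
  have := (MonoidHom.isMulCommutative_of_isCyclic_of_ker_le_center (π.subgroupComap N)
    (fun z hz => Subgroup.mem_center_iff.2 fun w => Subtype.ext
      (Subgroup.mem_center_iff.1 (hc (congrArg Subtype.val hz)) w))).is_comm.comm ⟨x, hx'⟩ ⟨y, hy'⟩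
  exact congrArg Subtype.val this

end AbelianByCyclic

/-! ### Factor sets and transgression -/

section CentralExtension

variable {Y G : Type*} [Group Y] [Group G] {π : Y →* G} (hπ : Function.Surjective π)
  (hc : π.ker ≤ Subgroup.center Y)

/-- The factor set of a central extension, for the section `Function.surjInv`. -/
noncomputable def factorSet (a b : G) : Subgroup.center Y :=
  ⟨Function.surjInv hπ a * Function.surjInv hπ b * (Function.surjInv hπ (a * b))⁻¹, hc (by
    simp [MonoidHom.mem_ker, Function.surjInv_eq])⟩

theorem factorSet_mul (a b : G) : (factorSet hπ hc a b : Y) * Function.surjInv hπ (a * b) =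
    Function.surjInv hπ a * Function.surjInv hπ b := by
  simp [factorSet]

theorem factorSet_cocycle (a b c : G) : factorSet hπ hc (a * b) c * factorSet hπ hc a b =
    factorSet hπ hc b c * factorSet hπ hc a (b * c) := by
  apply Subtype.ext
  have hz : ∀ x y, (factorSet hπ hc x y : Y) ∈ Subgroup.center Y := fun x y => Subtype.prop _
  apply mul_right_cancel (b := Function.surjInv hπ (a * b * c))
  simp only [Subgroup.coe_mul]
  calc _ = (factorSet hπ hc a b : Y) *
        ((factorSet hπ hc (a * b) c : Y) * Function.surjInv hπ (a * b * c)) := by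
        rw [← Subgroup.mem_center_iff.1 (hz (a * b) c), mul_assoc]
    _ = Function.surjInv hπ a * (Function.surjInv hπ b * Function.surjInv hπ c) := by
        rw [factorSet_mul, ← mul_assoc, factorSet_mul, mul_assoc]
    _ = (factorSet hπ hc b c : Y) * (Function.surjInv hπ a * Function.surjInv hπ (b * c)) := by
        rw [← factorSet_mul hπ hc b c, ← mul_assoc, Subgroup.mem_center_iff.1 (hz b c), mul_assoc]
    _ = _ := by rw [← factorSet_mul hπ hc, mul_assoc a, mul_assoc]

/-- The cocycle obtained by pushing a central extension out along a character of the centre. -/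
noncomputable def transgression (χ : Subgroup.center Y →* Multiplicative QmodZ) (a b : G) : QmodZ :=
  (χ (factorSet hπ hc a b)).toAdd

theorem isQZCocycle_transgression (χ : Subgroup.center Y →* Multiplicative QmodZ) :
    IsQZCocycle (transgression hπ hc χ) := fun a b c => by
  simp only [transgression, ← toAdd_mul, ← map_mul, factorSet_cocycle]

/-- The central part `d y` of `y` is multiplicative up to the factor set; a cochain bounding the
pushout corrects `χ ∘ d` to a homomorphism. -/
theorem exists_extension_of_isQZCoboundary (χ : Subgroup.center Y →* Multiplicative QmodZ)
    (h : IsQZCoboundary (transgression hπ hc χ)) :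
    ∃ r : Y →* Multiplicative QmodZ, ∀ k (hk : k ∈ π.ker), r k = χ ⟨k, hc hk⟩ := by
  obtain ⟨φ, hφ⟩ := h
  have hd : ∀ y, y * (Function.surjInv hπ (π y))⁻¹ ∈ π.ker := fun y => by
    simp [MonoidHom.mem_ker, Function.surjInv_eq]
  let d : Y → Subgroup.center Y := fun y => ⟨_, hc (hd y)⟩
  have hdy : ∀ y, (d y : Y) * Function.surjInv hπ (π y) = y := fun y => by simp [d]
  have hdmul : ∀ y z, d (y * z) = d y * d z * factorSet hπ hc (π y) (π z) := fun y z => by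
    apply Subtype.ext
    apply mul_right_cancel (b := Function.surjInv hπ (π (y * z)))
    rw [hdy, Subgroup.coe_mul, map_mul, mul_assoc, factorSet_mul, Subgroup.coe_mul]
    have := Subgroup.mem_center_iff.1 (d z).2 (Function.surjInv hπ (π y))
    calc y * z = (d y : Y) * Function.surjInv hπ (π y) * (d z * Function.surjInv hπ (π z)) := by
          rw [hdy, hdy]
      _ = d y * (Function.surjInv hπ (π y) * d z) * Function.surjInv hπ (π z) := by
          simp only [mul_assoc]
      _ = _ := by rw [this]; simp only [mul_assoc]
  let r : Y →* Multiplicative QmodZ := MonoidHom.mk'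
    (fun y => χ (d y) * Multiplicative.ofAdd (φ (π y))) fun y z => by
      rw [hdmul, map_mul, map_mul, map_mul π]
      apply Multiplicative.toAdd.injective
      have := hφ (π y) (π z)
      simp only [transgression] at this
      simp only [toAdd_mul, toAdd_ofAdd, ← this]
      abel
  refine ⟨r, fun k hk => ?_⟩
  -- The section need not send `1` to `1`; the discrepancy `factorSet 1 1` is absorbed by `φ 1`.
  have h1 : factorSet hπ hc 1 1 * d k = ⟨k, hc hk⟩ := by
    apply Subtype.ext
    have := Subgroup.mem_center_iff.1 (d k).2 (factorSet hπ hc 1 1 : Y)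
    rw [Subgroup.coe_mul, this]
    simp [d, factorSet, MonoidHom.mem_ker.1 hk]
  have h2 := hφ 1 1
  rw [← h1, map_mul, mul_comm]
  apply Multiplicative.toAdd.injective
  simp only [mul_one, transgression, sub_self, zero_add] at h2
  simp [r, MonoidHom.mem_ker.1 hk, h2]

theorem transgression_comm (χ : Subgroup.center Y →* Multiplicative QmodZ) {a b : G}
    (h : Commute (Function.surjInv hπ a) (Function.surjInv hπ b)) :
    transgression hπ hc χ a b = transgression hπ hc χ b a := by
  have hab : a * b = b * a := by
    have := congrArg π h.eq
    simpa [Function.surjInv_eq] using this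
  simp only [transgression, factorSet, h.eq, hab]

end CentralExtension

/-! ### Central extensions when `H²(G, ℚ/ℤ)` is small -/

/-- The group `H²(G, ℚ/ℤ)` has at most two elements. -/
def CocyclesAtMostTwo (G : Type*) [Group G] : Prop :=
  ∀ f g : G → G → QmodZ, IsQZCocycle f → IsQZCocycle g →
    IsQZCoboundary f ∨ IsQZCoboundary g ∨ IsQZCoboundary (f + g)

open scoped IsMulCommutative commutatorElement in
theorem CommSymmCocyclesTrivial.of_central_extension {X G : Type*} [Group X] [Group G]
    (π : X →* G) (hπ : Function.Surjective π) (hc : π.ker ≤ Subgroup.center X)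
    (hG : CommSymmCocyclesTrivial G) (hG2 : CocyclesAtMostTwo G) : CommSymmCocyclesTrivial X := by
  intro f hf hs
  have hρ : Function.Surjective (π.comp (CocycleExt.proj hf)) :=
    hπ.comp (CocycleExt.proj_surjective hf)
  have hρc : (π.comp (CocycleExt.proj hf)).ker ≤ Subgroup.center _ := fun y hy =>
    Subgroup.mem_center_iff.2 fun z => CocycleExt.commute_of_commute_proj hs
      (Subgroup.mem_center_iff.1 (hc hy) _)
  have hι : ∀ a, CocycleExt.incl hf a ∈ (π.comp (CocycleExt.proj hf)).ker := fun a => by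
    rw [MonoidHom.mem_ker, MonoidHom.comp_apply, CocycleExt.proj_incl, map_one]
  let ι : Multiplicative QmodZ →* Subgroup.center (CocycleExt hf) :=
    (CocycleExt.incl hf).codRestrict _ fun a => hρc (hι a)
  obtain ⟨χ, hχ⟩ := exists_monoidHom_comp_eq (K := Multiplicative QmodZ)
    (B := Subgroup.center (CocycleExt hf)) ι (MonoidHom.id _) fun a ha => by
    have h1 : CocycleExt.incl hf a = 1 := congrArg Subtype.val ha
    exact CocycleExt.incl_injective hf (h1.trans (map_one _).symm)
  -- Any extension of the identity of `ℚ/ℤ` will do, which leaves freedom to multiply `χ` by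
  -- characters killing `ℚ/ℤ`.
  have key : ∀ χ' : Subgroup.center (CocycleExt hf) →* Multiplicative QmodZ,
      (∀ a, χ' (ι a) = a) → IsQZCoboundary (transgression hρ hρc χ') → IsQZCoboundary f := by
    intro χ' hχ' h
    obtain ⟨r, hr⟩ := exists_extension_of_isQZCoboundary hρ hρc χ' h
    exact CocycleExt.isQZCoboundary_of_retraction r fun a => (hr _ (hι a)).trans (hχ' a)
  by_cases hψ : ∀ ψ : Subgroup.center (CocycleExt hf) →* Multiplicative QmodZ,
      (∀ s ∈ ι.range, ψ s = 1) → IsQZCoboundary (transgression hρ hρc ψ)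
  · refine key χ hχ (hG _ (isQZCocycle_transgression hρ hρc χ) fun a b hab => ?_)
    apply transgression_comm
    set y := Function.surjInv hρ a with hy
    set z := Function.surjInv hρ b with hz
    have hmem : ⁅y, z⁆ ∈ (π.comp (CocycleExt.proj hf)).ker := by
      rw [MonoidHom.mem_ker, map_commutatorElement, hy, hz, Function.surjInv_eq hρ,
        Function.surjInv_eq hρ, commutatorElement_eq_one_iff_commute]
      exact hab
    -- Otherwise a character killing `ℚ/ℤ` but not `⁅y, z⁆` would agree on the kernel with a
    -- character of the whole extension, which kills commutators.
    have hin : (⟨⁅y, z⁆, hρc hmem⟩ : Subgroup.center (CocycleExt hf)) ∈ ι.range := by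
      by_contra hb
      obtain ⟨ψ, h1, h2⟩ := exists_monoidHom_ne_one _ hb
      obtain ⟨r, hr⟩ := exists_extension_of_isQZCoboundary hρ hρc ψ (hψ ψ h1)
      refine h2 ((hr _ hmem).symm.trans ?_)
      rw [map_commutatorElement, commutatorElement_eq_one_iff_commute]
      exact Commute.all _ _
    obtain ⟨t, ht⟩ := hin
    apply CocycleExt.commute_of_commute_proj hs
    have ht' : CocycleExt.incl hf t = ⁅y, z⁆ := congrArg Subtype.val ht
    rw [← commutatorElement_eq_one_iff_commute, ← map_commutatorElement, ← ht',
      CocycleExt.proj_incl]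
  -- Twisting by `ψ` switches between the two classes of `H²(G, ℚ/ℤ)`.
  · push Not at hψ
    obtain ⟨ψ, h1, h2⟩ := hψ
    rcases hG2 _ _ (isQZCocycle_transgression hρ hρc ψ) (isQZCocycle_transgression hρ hρc χ)
      with h | h | h
    · exact absurd h h2
    · exact key χ hχ h
    · refine key (ψ * χ) (fun a => ?_) ?_
      · rw [MonoidHom.mul_apply, h1 _ ⟨a, rfl⟩, one_mul, hχ, MonoidHom.id_apply]
      · exact h
-- Comparison with group homology and cohomology
section Bridge

variable {G : Type u}

/-- Evaluation of 2-chains on a `ℚ/ℤ`-valued function. -/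
noncomputable def chainEval (f : G → G → QmodZ) : (G × G →₀ ULift.{u} ℤ) →+ QmodZ :=
  Finsupp.liftAddHom fun p =>
    (zmultiplesHom QmodZ (f p.1 p.2)).comp (AddEquiv.ulift.toAddMonoidHom)

@[simp]
theorem chainEval_single (f : G → G → QmodZ) (p : G × G) (n : ULift.{u} ℤ) :
    chainEval f (Finsupp.single p n) = n.down • f p.1 p.2 := by
  rw [chainEval, Finsupp.liftAddHom_apply_single]
  rfl

variable [Group G]

/-- The group cohomology cocycle defined by a `ℚ/ℤ`-valued cocycle. -/
noncomputable def IsQZCocycle.toCocycles₂ {f : G → G → QmodZ} (hf : IsQZCocycle f) :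
    groupCohomology.cocycles₂ (trivialQZ G) :=
  ⟨fun p => ULift.up (f p.1 p.2), (groupCohomology.mem_cocycles₂_iff _).2 fun x y z =>
    ULift.ext _ _ (hf x y z)⟩

theorem isQZCocycle_down (z : groupCohomology.cocycles₂ (trivialQZ G)) :
    IsQZCocycle fun x y => (z (x, y)).down := fun x y t =>
  congrArg ULift.down ((groupCohomology.mem_cocycles₂_iff _).1 z.2 x y t)

theorem H2π_eq_zero_iff_isQZCoboundary (z : groupCohomology.cocycles₂ (trivialQZ G)) :
    groupCohomology.H2π (trivialQZ G) z = 0 ↔ IsQZCoboundary fun x y => (z (x, y)).down := by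
  rw [groupCohomology.H2π_eq_zero_iff]
  constructor
  · rintro ⟨φ, hφ⟩
    exact ⟨fun x => (φ x).down, fun x y => congrArg ULift.down (congrFun hφ (x, y))⟩
  · rintro ⟨φ, hφ⟩
    exact ⟨fun x => ULift.up (φ x), funext fun p => ULift.ext _ _ (hφ p.1 p.2)⟩

theorem restrictionH2_H2π (A : Subgroup G) (z : groupCohomology.cocycles₂ (trivialQZ G)) :
    restrictionH2 A (groupCohomology.H2π (trivialQZ G) z) = 0 ↔
      IsQZCoboundary fun x y : A => (z ((x : G), (y : G))).down := by
  have h := congrArg (fun m => m.hom z) (groupCohomology.H2π_comp_map (A := trivialQZ G)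
    (B := trivialQZ A) A.subtype (Rep.ofHom ⟨LinearMap.id, fun _ => rfl⟩))
  have h' : restrictionH2 A (groupCohomology.H2π (trivialQZ G) z) =
    groupCohomology.H2π (trivialQZ A) (groupCohomology.mapCocycles₂ (A := trivialQZ G)
      (B := trivialQZ A) A.subtype (Rep.ofHom ⟨LinearMap.id, fun _ => rfl⟩) z) := h
  rw [h', H2π_eq_zero_iff_isQZCoboundary]
  rfl

/-- A commuting pair generates an abelian subgroup, on which coboundaries are symmetric. Conversely,
a symmetric cocycle on an abelian group defines an abelian extension, which splits since `ℚ/ℤ` is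
injective. -/
theorem H2π_mem_bogomolovMultiplier_iff (z : groupCohomology.cocycles₂ (trivialQZ G)) :
    groupCohomology.H2π (trivialQZ G) z ∈ bogomolovMultiplier G ↔
      ∀ x y, Commute x y → (z (x, y)).down = (z (y, x)).down := by
  simp only [bogomolovMultiplier, Submodule.mem_iInf, LinearMap.mem_ker]
  constructor
  · intro h x y hxy
    have hA : IsMulCommutative (Subgroup.closure {x, y}) := by
      refine Subgroup.isMulCommutative_closure ?_
      rintro a (rfl | rfl) b (rfl | rfl)
      exacts [rfl, hxy.eq, hxy.eq.symm, rfl]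
    obtain ⟨φ, hφ⟩ := (restrictionH2_H2π _ z).1 (h _ hA)
    have h1 := hφ ⟨x, Subgroup.subset_closure (by simp)⟩ ⟨y, Subgroup.subset_closure (by simp)⟩
    have h2 := hφ ⟨y, Subgroup.subset_closure (by simp)⟩ ⟨x, Subgroup.subset_closure (by simp)⟩
    simp only at h1 h2
    rw [← h1, ← h2]
    simp only [MulMemClass.mk_mul_mk, hxy.eq]
    abel
  · intro h A hA
    exact (restrictionH2_H2π A z).2 <| IsQZCocycle.isQZCoboundary_of_symm
      (f := fun x y : A => (z ((x : G), (y : G))).down)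
      (fun x y t => isQZCocycle_down z x y t) (fun x y => hA.is_comm.comm x y)
      fun x y => h x y (congrArg Subtype.val (hA.is_comm.comm x y))

theorem bogomolovMultiplier_eq_bot_iff :
    bogomolovMultiplier G = ⊥ ↔ CommSymmCocyclesTrivial G := by
  constructor
  · intro h f hf hs
    have h1 : groupCohomology.H2π (trivialQZ G) hf.toCocycles₂ ∈ bogomolovMultiplier G :=
      (H2π_mem_bogomolovMultiplier_iff _).2 hs
    rw [h, Submodule.mem_bot] at h1
    exact (H2π_eq_zero_iff_isQZCoboundary _).1 h1
  · intro h
    rw [eq_bot_iff]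
    intro c
    induction c using groupCohomology.H2_induction_on with
    | h z =>
      intro hz
      exact (H2π_eq_zero_iff_isQZCoboundary _).2
        (h _ (isQZCocycle_down z) ((H2π_mem_bogomolovMultiplier_iff z).1 hz))

theorem chainEval_d₃₂ {f : G → G → QmodZ} (hf : IsQZCocycle f) (x : G × G × G →₀ ULift.{u} ℤ) :
    chainEval f ((groupHomology.d₃₂ (trivialZ G)).hom x) = 0 := by
  induction x using Finsupp.induction_linear with
  | zero => rw [map_zero, map_zero]
  | add x y hx hy => rw [map_add, map_add, hx, hy, add_zero]
  | single p n =>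
    have h := groupHomology.d₃₂_single (A := trivialZ G) p n
    refine (congrArg (chainEval f) h).trans ?_
    simp only [map_add, map_sub, chainEval_single, trivialZ, Representation.trivial_apply]
    have hp := congrArg (n.down • ·) (hf p.1 p.2.1 p.2.2)
    simp only [smul_add] at hp
    rw [sub_eq_zero, sub_add_eq_add_sub, ← hp]
    abel

/-- A cocycle that vanishes on 2-cycles is a coboundary. -/
theorem isQZCoboundary_of_chainEval {f : G → G → QmodZ}
    (h : ∀ x ∈ groupHomology.cycles₂ (trivialZ G), chainEval f x = 0) : IsQZCoboundary f := by
  -- Evaluation kills the kernel of `d₂₁`, so it factors through `d₂₁`; the values of the factor on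
  -- basis 1-chains bound `f`.
  obtain ⟨ψ, hψ⟩ := exists_addMonoidHom_comp_eq
    (groupHomology.d₂₁ (trivialZ G)).hom.toAddMonoidHom (chainEval f) fun x hx => h x hx
  refine ⟨fun x => ψ (Finsupp.single x (ULift.up 1)), fun x y => ?_⟩
  have h1 := hψ (Finsupp.single (x, y) (ULift.up 1))
  have h2 := groupHomology.d₂₁_single (A := trivialZ G) (x, y) (ULift.up 1)
  have h3 := (congrArg ψ h2).symm.trans h1
  simpa using h3

/-- A cocycle defines a character of the Schur multiplier. -/
theorem exists_schurMultiplier_character {f : G → G → QmodZ} (hf : IsQZCocycle f) :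
    ∃ e : SchurMultiplier G →+ QmodZ, ∀ x : groupHomology.cycles₂ (trivialZ G),
      e (groupHomology.H2π (trivialZ G) x) = chainEval f x.1 := by
  refine exists_addMonoidHom_comp_eq (groupHomology.H2π (trivialZ G)).hom.toAddMonoidHom
    ((chainEval f).comp (groupHomology.cycles₂ (trivialZ G)).toAddSubgroup.subtype)
    fun x hx => ?_
  obtain ⟨y, hy⟩ := (groupHomology.H2π_eq_zero_iff (A := trivialZ G) x).1 hx
  have := chainEval_d₃₂ hf y
  rw [hy] at this
  exact this

/-- A character is determined by its value on the generator, which is `0` or `1/2`. -/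
theorem eq_zero_or_eq_zero_or_add_eq_zero {M : Type*} [AddCommGroup M] (φ : M ≃+ ZMod 2)
    (a b : M →+ QmodZ) : a = 0 ∨ b = 0 ∨ a + b = 0 := by
  have hM : ∀ m : M, m = 0 ∨ m = φ.symm 1 := fun m => by
    obtain ⟨n, rfl⟩ := φ.symm.surjective m
    fin_cases n
    · exact Or.inl (map_zero _)
    · exact Or.inr rfl
  have hzero : ∀ c : M →+ QmodZ, c (φ.symm 1) = 0 → c = 0 := fun c hc => by
    ext m
    rcases hM m with rfl | rfl
    · simp
    · exact hc
  have hhalf : ∀ c : M →+ QmodZ, c (φ.symm 1) = 0 ∨ c (φ.symm 1) = ((1 / 2 : ℚ) : QmodZ) :=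
    fun c => by
      have h2 : 2 • c (φ.symm 1) = 0 := by
        rw [← map_nsmul, ← map_nsmul, show 2 • (1 : ZMod 2) = 0 from rfl, map_zero, map_zero]
      obtain ⟨k, hk, h⟩ := (AddCircle.nsmul_eq_zero_iff two_pos).1 h2
      rw [← h]
      interval_cases k <;> simp
  rcases hhalf a with h | h
  · exact Or.inl (hzero a h)
  rcases hhalf b with h' | h'
  · exact Or.inr (Or.inl (hzero b h'))
  refine Or.inr (Or.inr (hzero _ ?_))
  rw [AddMonoidHom.add_apply, h, h', ← AddCircle.coe_add, add_halves]
  exact AddCircle.coe_period 1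

/-- A cocycle inducing the zero character of `M(G)` vanishes on 2-cycles, so `H²(G, ℚ/ℤ)` embeds in
the dual of `M(G)`. -/
theorem cocyclesAtMostTwo_of_zmod_two (φ : SchurMultiplier G ≃+ ZMod 2) : CocyclesAtMostTwo G := by
  intro f g hf hg
  obtain ⟨a, ha⟩ := exists_schurMultiplier_character hf
  obtain ⟨b, hb⟩ := exists_schurMultiplier_character hg
  rcases eq_zero_or_eq_zero_or_add_eq_zero φ a b with h | h | h
  · exact Or.inl (isQZCoboundary_of_chainEval fun x hx => by rw [← ha ⟨x, hx⟩, h]; rfl)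
  · exact Or.inr (Or.inl (isQZCoboundary_of_chainEval fun x hx => by rw [← hb ⟨x, hx⟩, h]; rfl))
  · refine Or.inr (Or.inr (isQZCoboundary_of_chainEval fun x hx => ?_))
    have h1 : chainEval (f + g) = chainEval f + chainEval g := by
      ext p
      simp
    rw [h1, AddMonoidHom.add_apply, ← ha ⟨x, hx⟩, ← hb ⟨x, hx⟩, ← AddMonoidHom.add_apply, h]
    rfl

theorem isQZCoboundary_of_subsingleton [Subsingleton (SchurMultiplier G)] {f : G → G → QmodZ}
    (hf : IsQZCocycle f) : IsQZCoboundary f := by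
  obtain ⟨a, ha⟩ := exists_schurMultiplier_character hf
  refine isQZCoboundary_of_chainEval fun x hx => ?_
  rw [← ha ⟨x, hx⟩, Subsingleton.elim (groupHomology.H2π (trivialZ G) ⟨x, hx⟩) 0, map_zero]

end Bridge

/-! ### The main theorem -/

theorem mainTheorem7 {G : Type u} {X : Type v} {C : Type w} [Group G] [Group X] [Group C]
    (hG : IsMetacyclic G ∨ Subsingleton (SchurMultiplier G) ∨
      (Nonempty (SchurMultiplier G ≃+ ZMod 2) ∧ bogomolovMultiplier G = ⊥))
    (E : GroupExtension C X G) (hE : E.inl.range ≤ Subgroup.center X) :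
    bogomolovMultiplier X = ⊥ := by
  rw [E.range_inl_eq_ker_rightHom] at hE
  rw [bogomolovMultiplier_eq_bot_iff]
  rcases hG with h | h | ⟨⟨φ⟩, h⟩
  · exact .of_central_extension_isMetacyclic E.rightHom E.rightHom_surjective hE h
  · exact .of_central_extension E.rightHom E.rightHom_surjective hE
      (fun f hf _ => isQZCoboundary_of_subsingleton hf)
      (fun f _ hf _ => Or.inl (isQZCoboundary_of_subsingleton hf))
  · exact .of_central_extension E.rightHom E.rightHom_surjective hE
      (bogomolovMultiplier_eq_bot_iff.1 h) (cocyclesAtMostTwo_of_zmod_two φ)
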